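/- Let $G$ be a locally compact Hausdorff topological group which is amenable, that is, every continuous affine action of $G$ on a non-empty compact convex subset of a Hausdorff locally convex space has a fixed point. Let $(X,\mu)$ be a non-atomic Lebesgue space, that is, a probability space isomorphic modulo null sets to the unit interval with Lebesgue measure. Let $L_0(X,G)$ be the group, under pointwise multiplication, of all measurable maps $X\to G$ modulo equality $\mu$-almost everywhere, where a map is called measurable if it is $\mu$-almost everywhere the pointwise limit of a sequence of measurable maps with finitely many values (for second countable $G$ these are, modulo null sets, exactly the Borel-measurable maps). Equip $L_0(X,G)$ with the topology of convergence in measure, in which a basis of neighbourhoods of $f$ is given by the sets $$\{g\in L_0(X,G) : \mu\{x\in X : f(x)^{-1}g(x)\notin V\}<\varepsilon\},$$ where $V$ runs over the neighbourhoods of the identity in $G$, $\varepsilon>0$, and $\mu$ of a possibly non-measurable set is understood as outer measure. Then the topological group $L_0(X,G)$ is extremely amenable: every continuous action of $L_0(X,G)$ on a non-empty compact Hausdorff space has a fixed point. -/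

import Mathlib

open MeasureTheory Set Filter Topology
open scoped ENNReal

universe u v w

/-- A topological group `G` is *amenable* if every (jointly) continuous affine action of `G` on a
nonempty compact convex subset of a Hausdorff locally convex space has a fixed point.
Letting the locally convex space range over the universe of `G` loses nothing: already the set of
means on the bounded right uniformly continuous functions on `G` detects amenability. -/
def AmenableTopGroup (G : Type u) [Group G] [TopologicalSpace G] : Prop :=
  ∀ (E : Type u) [AddCommGroup E] [Module ℝ E] [TopologicalSpace E] [IsTopologicalAddGroup E]
    [ContinuousSMul ℝ E] [LocallyConvexSpace ℝ E] [T2Space E]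
    (K : Set E) [MulAction G K] [ContinuousSMul G K],
    IsCompact K → Convex ℝ K → K.Nonempty →
    (∀ (g : G) (x y z : K) (a b : ℝ), 0 ≤ a → 0 ≤ b → a + b = 1 →
      (z : E) = a • (x : E) + b • (y : E) →
      ((g • z : K) : E) = a • ((g • x : K) : E) + b • ((g • y : K) : E)) →
    ∃ x : K, ∀ g : G, g • x = x

/-- A topological group `H` is *extremely amenable* (has the fixed point on compacta property) if
every (jointly) continuous action of `H` on a nonempty compact Hausdorff space has a fixed point. -/
def ExtremelyAmenable (H : Type u) [Group H] [TopologicalSpace H] : Prop :=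
  ∀ (K : Type v) [TopologicalSpace K] [CompactSpace K] [T2Space K] [Nonempty K]
    [MulAction H K] [ContinuousSMul H K], ∃ x : K, ∀ h : H, h • x = x

/-- `(X, μ)` is a *non-atomic Lebesgue space*: it is isomorphic modulo null sets to the unit
interval with Lebesgue measure. The maps `φ` and `ψ` are mutually inverse bijections between
`{x | ψ (φ x) = x}` and `{t | φ (ψ t) = t}`, which have full measure. Null-measurability is used so
that the σ-algebra of `X` may or may not be complete for `μ`. -/
def IsNonatomicLebesgueSpace {X : Type*} [MeasurableSpace X] (μ : Measure X) : Prop :=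
  ∃ (φ : X → unitInterval) (ψ : unitInterval → X),
    NullMeasurable φ μ ∧ NullMeasurable ψ volume ∧
    (∀ s : Set unitInterval, MeasurableSet s → μ (φ ⁻¹' s) = volume s) ∧
    (∀ s : Set X, MeasurableSet s → volume (ψ ⁻¹' s) = μ s) ∧
    (∀ᵐ x ∂μ, ψ (φ x) = x) ∧ (∀ᵐ t ∂(volume : Measure unitInterval), φ (ψ t) = t)

namespace HartmanMycielski

/- The group `L₀(X, G)` is Mathlib's group `X →ₘ[μ] G` of classes, modulo equality almost
everywhere, of maps `X → G` that are almost everywhere the pointwise limit of a sequence of simple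
functions. For second countable metrizable `G` these are exactly the classes of Borel-measurable
maps; for general `G` this is the notion of measurability under which the maps form a group. -/

variable {X : Type*} [MeasurableSpace X] {μ : Measure X}
  {G : Type*} [Group G] [TopologicalSpace G] [IsTopologicalGroup G]

/-- The basic neighbourhood `[V, ε] = {h | μ {x | h x ∉ V} < ε}` of the identity in the group
`X →ₘ[μ] G` of measurable maps modulo equality almost everywhere. -/
def basicNhd (μ : Measure X) (V : Set G) (ε : ℝ≥0∞) : Set (X →ₘ[μ] G) :=
  {h | μ {x | h x ∉ V} < ε}

theorem exists_simple [IsFiniteMeasure μ] (f : X →ₘ[μ] G) {V : Set G} (hV : V ∈ 𝓝 (1 : G))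
    {ε : ℝ≥0∞} (hε : 0 < ε) :
    ∃ s : SimpleFunc X G, μ {x | f x * (s x)⁻¹ ∉ V} < ε := by
  let _ : UniformSpace G := IsTopologicalGroup.rightUniformSpace G
  obtain ⟨U, hUV, hUo, hU1⟩ := mem_nhds_iff.1 hV
  obtain ⟨p, hp, hp1, hpU⟩ := CompletelyRegularSpace.completely_regular (1 : G) Uᶜ
    hUo.isClosed_compl (by simpa using hU1)
  have hf : StronglyMeasurable f := f.stronglyMeasurable
  let F : ℕ → X → ℝ := fun n x => (p (f x * (hf.approx n x)⁻¹) : ℝ)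
  have hpc : Continuous fun y => (p y : ℝ) := continuous_subtype_val.comp hp
  have hF : ∀ n, AEStronglyMeasurable (F n) μ := fun n =>
    (hpc.comp_stronglyMeasurable
      (hf.mul ((hf.approx n).stronglyMeasurable.inv))).aestronglyMeasurable
  have hlim : ∀ x, Tendsto (fun n => F n x) atTop (𝓝 0) := by
    intro x
    have h1 : Tendsto (fun n => f x * (hf.approx n x)⁻¹) atTop (𝓝 (f x * (f x)⁻¹)) :=
      tendsto_const_nhds.mul ((hf.tendsto_approx x).inv)
    rw [mul_inv_cancel] at h1
    have h2 := (hpc.tendsto 1).comp h1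
    simpa [hp1, F, Function.comp_def] using h2
  have hm := tendstoInMeasure_of_tendsto_ae (g := fun _ => (0 : ℝ)) hF (ae_of_all μ hlim)
  have h3 := hm 1 one_pos
  obtain ⟨n, hn⟩ := (h3.eventually (gt_mem_nhds hε)).exists
  refine ⟨hf.approx n, lt_of_le_of_lt (measure_mono ?_) hn⟩
  intro x hx
  have hx' : f x * (hf.approx n x)⁻¹ ∈ Uᶜ := fun h => hx (hUV h)
  have := hpU hx'
  simp [F, this, edist_dist]

/-- The basic neighbourhoods `[V, ε]`, with `V` a neighbourhood of `1` in `G` and `ε > 0`, form a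
basis of neighbourhoods of the identity for a group topology. -/
@[reducible]
def basis (μ : Measure X) [IsFiniteMeasure μ] (G : Type*) [Group G] [TopologicalSpace G]
    [IsTopologicalGroup G] : GroupFilterBasis (X →ₘ[μ] G) where
  sets := {S | ∃ V ∈ 𝓝 (1 : G), ∃ ε : ℝ≥0∞, 0 < ε ∧ S = basicNhd μ V ε}
  nonempty := ⟨_, univ, univ_mem, 1, one_pos, rfl⟩
  inter_sets := by
    rintro _ _ ⟨V, hV, ε, hε, rfl⟩ ⟨W, hW, δ, hδ, rfl⟩
    refine ⟨_, ⟨V ∩ W, inter_mem hV hW, min ε δ, lt_min hε hδ, rfl⟩, fun h hh => ⟨?_, ?_⟩⟩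
    · exact lt_of_le_of_lt (measure_mono fun x (hx : h x ∉ _) (hx' : h x ∈ V ∩ W) => hx hx'.1)
        (lt_of_lt_of_le hh (min_le_left _ _))
    · exact lt_of_le_of_lt (measure_mono fun x (hx : h x ∉ _) (hx' : h x ∈ V ∩ W) => hx hx'.2)
        (lt_of_lt_of_le hh (min_le_right _ _))
  one' := by
    rintro _ ⟨V, hV, ε, hε, rfl⟩
    refine lt_of_eq_of_lt ?_ hε
    change ∀ᵐ x ∂μ, (1 : X →ₘ[μ] G) x ∈ V
    filter_upwards [AEEqFun.coeFn_one (μ := μ) (β := G)] with x hx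
    rw [hx]
    exact mem_of_mem_nhds hV
  mul' := by
    rintro _ ⟨V, hV, ε, hε, rfl⟩
    obtain ⟨W, hWo, hW1, hW⟩ := exists_open_nhds_one_mul_subset hV
    refine ⟨_, ⟨W, hWo.mem_nhds hW1, ε / 2, ENNReal.half_pos hε.ne', rfl⟩, ?_⟩
    rintro _ ⟨f, hf, g, hg, rfl⟩
    have hle : μ {x | (f * g : X →ₘ[μ] G) x ∉ V} ≤ μ ({x | f x ∉ W} ∪ {x | g x ∉ W}) := by
      refine measure_mono_ae ?_
      filter_upwards [AEEqFun.coeFn_mul f g] with x hx hxV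
      by_contra hcon
      refine hxV ?_
      rw [hx]
      exact hW (Set.mul_mem_mul (by by_contra h; exact hcon (Or.inl h))
        (by by_contra h; exact hcon (Or.inr h)))
    refine lt_of_le_of_lt (hle.trans (measure_union_le _ _)) ?_
    exact (ENNReal.add_lt_add hf hg).trans_eq (ENNReal.add_halves ε)
  inv' := by
    rintro _ ⟨V, hV, ε, hε, rfl⟩
    refine ⟨_, ⟨V⁻¹, inv_mem_nhds_one G hV, ε, hε, rfl⟩, fun f hf => ?_⟩
    refine lt_of_le_of_lt (measure_mono_ae ?_) hf
    filter_upwards [AEEqFun.coeFn_inv f] with x hx hxV h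
    refine hxV ?_
    change (f⁻¹ : X →ₘ[μ] G) x ∈ V
    rw [hx]
    exact h
  conj' := by
    rintro f _ ⟨V, hV, ε, hε, rfl⟩
    have hV3 : ∀ᶠ q : G × G in 𝓝 1 ×ˢ 𝓝 1, q.1 * q.2 * q.1⁻¹ ∈ V := by
      have h : Continuous fun q : G × G => q.1 * q.2 * q.1⁻¹ := by fun_prop
      have h2 := h.tendsto (1, 1)
      rw [nhds_prod_eq] at h2
      simp only [mul_one, inv_one] at h2
      exact h2 hV
    obtain ⟨U, hU, hUV⟩ := Filter.mem_prod_same_iff.1 hV3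
    obtain ⟨s, hs⟩ := exists_simple f hU (ENNReal.half_pos hε.ne')
    have hW : ∀ᶠ w in 𝓝 (1 : G), ∀ c ∈ s.range, c * w * c⁻¹ ∈ U := by
      refine (Filter.eventually_all_finset _).2 fun c _ => ?_
      have h : Continuous fun w : G => c * w * c⁻¹ := by fun_prop
      have h2 := h.tendsto 1
      simp only [mul_one, mul_inv_cancel] at h2
      exact h2 hU
    refine ⟨_, ⟨_, hW, ε / 2, ENNReal.half_pos hε.ne', rfl⟩, fun h hh => ?_⟩
    have hle : μ {x | (f * h * f⁻¹ : X →ₘ[μ] G) x ∉ V} ≤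
        μ ({x | f x * (s x)⁻¹ ∉ U} ∪
          {x | h x ∉ {w : G | ∀ c ∈ s.range, c * w * c⁻¹ ∈ U}}) := by
      refine measure_mono_ae ?_
      filter_upwards [AEEqFun.coeFn_mul (f * h) f⁻¹, AEEqFun.coeFn_mul f h, AEEqFun.coeFn_inv f]
        with x hx1 hx2 hx3 hxV
      by_contra hcon
      refine hxV ?_
      have h1 : f x * (s x)⁻¹ ∈ U := by
        by_contra h'
        exact hcon (Or.inl h')
      have h2 : h x ∈ {w : G | ∀ c ∈ s.range, c * w * c⁻¹ ∈ U} := by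
        by_contra h'
        exact hcon (Or.inr h')
      have h3 := hUV (Set.mk_mem_prod h1 (h2 (s x) (SimpleFunc.mem_range_self s x)))
      have h4 : f x * (s x)⁻¹ * (s x * h x * (s x)⁻¹) * (f x * (s x)⁻¹)⁻¹ ∈ V := h3
      have h5 : f x * (s x)⁻¹ * (s x * h x * (s x)⁻¹) * (f x * (s x)⁻¹)⁻¹
          = f x * h x * (f x)⁻¹ := by group
      rw [h5] at h4
      rw [hx1, Pi.mul_apply, hx2, Pi.mul_apply, hx3, Pi.inv_apply]
      exact h4
    refine lt_of_le_of_lt (hle.trans (measure_union_le _ _)) ?_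
    exact (ENNReal.add_lt_add hs hh).trans_eq (ENNReal.add_halves ε)

/-- The topology of convergence in measure on the group `X →ₘ[μ] G`. The neighbourhoods of `f` are
the sets containing some `f * [V, ε]`, that is, `{g | μ {x | (f x)⁻¹ * g x ∉ V} < ε}`. -/
instance topology [IsFiniteMeasure μ] : TopologicalSpace (X →ₘ[μ] G) :=
  (basis μ G).topology

instance [IsFiniteMeasure μ] : IsTopologicalGroup (X →ₘ[μ] G) :=
  (basis μ G).isTopologicalGroup

theorem hasBasis_nhds [IsFiniteMeasure μ] (f : X →ₘ[μ] G) :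
    (𝓝 f).HasBasis (fun q : Set G × ℝ≥0∞ => q.1 ∈ 𝓝 (1 : G) ∧ 0 < q.2)
      fun q => {g | μ {x | (f x)⁻¹ * g x ∉ q.1} < q.2} := by
  refine ⟨fun t => ?_⟩
  have key : ∀ (V : Set G) (ε : ℝ≥0∞), (fun y => f * y) '' basicNhd μ V ε =
      {g : X →ₘ[μ] G | μ {x | (f x)⁻¹ * g x ∉ V} < ε} := by
    intro V ε
    ext g
    have h : (f⁻¹ * g : X →ₘ[μ] G) =ᵐ[μ] fun x => (f x)⁻¹ * g x := by
      filter_upwards [AEEqFun.coeFn_mul f⁻¹ g, AEEqFun.coeFn_inv f] with x h1 h2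
      rw [h1, Pi.mul_apply, h2, Pi.inv_apply]
    have h' : μ {x | (f⁻¹ * g : X →ₘ[μ] G) x ∉ V} = μ {x | (f x)⁻¹ * g x ∉ V} := by
      refine measure_congr ?_
      filter_upwards [h] with x hx
      change ((f⁻¹ * g : X →ₘ[μ] G) x ∉ V) = ((f x)⁻¹ * g x ∉ V)
      rw [hx]
    rw [Set.image_mul_left, Set.mem_preimage]
    change μ {x | (f⁻¹ * g : X →ₘ[μ] G) x ∉ V} < ε ↔ μ {x | (f x)⁻¹ * g x ∉ V} < ε
    rw [h']
  rw [((basis μ G).nhds_hasBasis f).mem_iff]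
  constructor
  · rintro ⟨_, ⟨V, hV, ε, hε, rfl⟩, h⟩
    exact ⟨(V, ε), ⟨hV, hε⟩, by rw [← key]; exact h⟩
  · rintro ⟨⟨V, ε⟩, ⟨hV, hε⟩, h⟩
    exact ⟨_, ⟨V, hV, ε, hε, rfl⟩, by rw [key]; exact h⟩

end HartmanMycielski

/-! Amenability gives an invariant mean on the `IsBUC` functions on `G`; iterating it over
coordinates gives one on every finite power `ι → G`. An Efron–Stein argument
(`iterMean_mul_self_le`) bounds the variance under this mean by the sum of the squared oscillations
in single coordinates. Hence a Lipschitz function for the Hamming distance with weights `a i`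
concentrates around its mean once `∑ i, a i ^ 2` is small.

Finite powers map into `X →ₘ[μ] G` as step functions over finite partitions, the weights being the
measures of the pieces. Convergence in measure ignores small sets, so `r ↦ f (e r • y₀)`, for `f`
continuous on the compact space, changes little under elements of small Hamming weight and is
uniformly close to a Lipschitz function. Non-atomicity allows pieces of measure at most `1 / N`,
which makes the sum of squares at most `1 / N`. A translate has the same mean as the function
itself, so at some `r` finitely many such functions and their translates are all near their common
means (`exists_almost_fixed`). Approximating group elements by step functions then gives almost
fixed points, and compactness a fixed point. -/

/-! ### Bounded uniformly continuous functions and invariant means -/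

/-- Bounded functions on a topological group which are uniformly continuous with respect to
left translations by elements close to the identity. -/
def IsBUC {Γ : Type*} [Group Γ] [TopologicalSpace Γ] (f : Γ → ℝ) : Prop :=
  (∃ C, ∀ x, |f x| ≤ C) ∧ ∀ ε > 0, ∀ᶠ u in 𝓝 (1 : Γ), ∀ x, |f (u * x) - f x| ≤ ε

namespace IsBUC

variable {Γ : Type*} [Group Γ] [TopologicalSpace Γ] {f g : Γ → ℝ}

theorem const (c : ℝ) : IsBUC fun _ : Γ => c :=
  ⟨⟨|c|, fun _ => le_rfl⟩, fun ε hε => .of_forall fun _ _ => by simpa using hε.le⟩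

theorem add (hf : IsBUC f) (hg : IsBUC g) : IsBUC fun x => f x + g x := by
  obtain ⟨⟨C, hC⟩, hf⟩ := hf
  obtain ⟨⟨D, hD⟩, hg⟩ := hg
  refine ⟨⟨C + D, fun x => (abs_add_le _ _).trans (add_le_add (hC x) (hD x))⟩, fun ε hε => ?_⟩
  filter_upwards [hf (ε / 2) (half_pos hε), hg (ε / 2) (half_pos hε)] with u h1 h2 x
  have h1 := abs_le.1 (h1 x)
  have h2 := abs_le.1 (h2 x)
  exact abs_le.2 ⟨by linarith, by linarith⟩

theorem mul (hf : IsBUC f) (hg : IsBUC g) : IsBUC fun x => f x * g x := by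
  obtain ⟨⟨C, hC⟩, hf⟩ := hf
  obtain ⟨⟨D, hD⟩, hg⟩ := hg
  have hC0 : 0 ≤ C := (abs_nonneg _).trans (hC 1)
  have hD0 : 0 ≤ D := (abs_nonneg _).trans (hD 1)
  refine ⟨⟨C * D, fun x => ?_⟩, fun ε hε => ?_⟩
  · rw [abs_mul]
    exact mul_le_mul (hC x) (hD x) (abs_nonneg _) hC0
  · have hη : 0 < ε / (C + D + 1) := by positivity
    filter_upwards [hf _ hη, hg _ hη] with u h1 h2 x
    have hsplit : f (u * x) * g (u * x) - f x * g x =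
        f (u * x) * (g (u * x) - g x) + (f (u * x) - f x) * g x := by ring
    rw [hsplit]
    refine (abs_add_le _ _).trans ?_
    rw [abs_mul, abs_mul]
    calc |f (u * x)| * |g (u * x) - g x| + |f (u * x) - f x| * |g x|
        ≤ C * (ε / (C + D + 1)) + ε / (C + D + 1) * D := by
          gcongr
          exacts [hC _, h2 x, h1 x, hD x]
      _ ≤ (C + D + 1) * (ε / (C + D + 1)) := by nlinarith
      _ = ε := by field_simp

theorem const_mul (c : ℝ) (hf : IsBUC f) : IsBUC fun x => c * f x :=
  (const c).mul hf

theorem sum {κ : Type*} (s : Finset κ) {F : κ → Γ → ℝ} (h : ∀ k ∈ s, IsBUC (F k)) :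
    IsBUC fun x => ∑ k ∈ s, F k x := by
  classical
  induction s using Finset.induction_on with
  | empty => simpa using const 0
  | insert a s ha ih =>
    simp only [Finset.sum_insert ha]
    exact (h a (Finset.mem_insert_self _ _)).add
      (ih fun k hk => h k (Finset.mem_insert_of_mem hk))

theorem comp_mul_left [IsTopologicalGroup Γ] (hf : IsBUC f) (a : Γ) :
    IsBUC fun x => f (a * x) := by
  obtain ⟨⟨C, hC⟩, hf⟩ := hf
  refine ⟨⟨C, fun x => hC _⟩, fun ε hε => ?_⟩
  have h : Tendsto (fun u : Γ => a * u * a⁻¹) (𝓝 1) (𝓝 1) := by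
    have h : Continuous fun u : Γ => a * u * a⁻¹ := by fun_prop
    simpa using h.tendsto 1
  filter_upwards [h.eventually (hf ε hε)] with u hu x
  have := hu (a * x)
  rwa [show a * u * a⁻¹ * (a * x) = a * (u * x) by group] at this

end IsBUC

/-- A left-invariant mean on the bounded left-uniformly continuous functions. Values at other
functions are irrelevant. -/
structure IsInvariantMean {Γ : Type*} [Group Γ] [TopologicalSpace Γ] (M : (Γ → ℝ) → ℝ) :
    Prop where
  add : ∀ {f g : Γ → ℝ}, IsBUC f → IsBUC g → M (fun x => f x + g x) = M f + M g
  const_mul : ∀ {f : Γ → ℝ} (c : ℝ), IsBUC f → M (fun x => c * f x) = c * M f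
  le_of_forall_le : ∀ {f : Γ → ℝ} {c : ℝ}, IsBUC f → (∀ x, f x ≤ c) → M f ≤ c
  le_of_le_forall : ∀ {f : Γ → ℝ} {c : ℝ}, IsBUC f → (∀ x, c ≤ f x) → c ≤ M f
  comp_mul_left : ∀ {f : Γ → ℝ} (a : Γ), IsBUC f → M (fun x => f (a * x)) = M f

/-! ### From amenability to an invariant mean -/

section ExistsMean

variable (G : Type u) [Group G] [TopologicalSpace G]

/-- The means on the bounded uniformly continuous functions. -/
def meanSet : Set ({f : G → ℝ // IsBUC f} → ℝ) :=
  {m | (∀ (f g k : {f : G → ℝ // IsBUC f}) (a b : ℝ), (∀ x, k.1 x = a * f.1 x + b * g.1 x) →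
      m k = a * m f + b * m g) ∧
    ∀ (f : {f : G → ℝ // IsBUC f}) (c d : ℝ), (∀ x, f.1 x ∈ Icc c d) → m f ∈ Icc c d}

theorem isCompact_meanSet : IsCompact (meanSet G) := by
  choose C hC using fun f : {f : G → ℝ // IsBUC f} => f.2.1
  refine (isCompact_univ_pi fun f => isCompact_Icc (a := -C f) (b := C f)).of_isClosed_subset ?_
    fun m hm f _ => hm.2 f _ _ fun x => abs_le.1 (hC f x)
  simp only [meanSet, ofPred_and, ofPred_forall]
  refine IsClosed.inter ?_ ?_
  · refine isClosed_iInter fun f => isClosed_iInter fun g => isClosed_iInter fun k =>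
      isClosed_iInter fun a => isClosed_iInter fun b => isClosed_iInter fun _ => ?_
    exact isClosed_eq (by fun_prop) (by fun_prop)
  · refine isClosed_iInter fun f => isClosed_iInter fun c => isClosed_iInter fun d =>
      isClosed_iInter fun _ => ?_
    exact isClosed_Icc.preimage (continuous_apply f)

theorem convex_meanSet : Convex ℝ (meanSet G) := by
  intro m hm m' hm' a b ha hb hab
  refine ⟨fun f g k s t h => ?_, fun f c d h => ?_⟩
  · simp only [Pi.add_apply, Pi.smul_apply, smul_eq_mul, hm.1 f g k s t h, hm'.1 f g k s t h]
    ring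
  · exact convex_Icc c d (hm.2 f c d h) (hm'.2 f c d h) ha hb hab

theorem nonempty_meanSet : (meanSet G).Nonempty :=
  ⟨fun f => f.1 1, fun _ _ _ _ _ h => h 1, fun _ _ _ h => h 1⟩

variable [IsTopologicalGroup G]

/-- Left translation of a bounded uniformly continuous function. -/
def translateBUC (a : G) (f : {f : G → ℝ // IsBUC f}) : {f : G → ℝ // IsBUC f} :=
  ⟨fun x => f.1 (a * x), f.2.comp_mul_left a⟩

/-- Translating the argument on the left reverses the order of composition, and dualizing to means
reverses it again, so this is a left action without inverses. -/
instance meanSetAction : MulAction G (meanSet G) where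
  smul a m := ⟨fun f => m.1 (translateBUC G a f),
    fun f g k s t h => m.2.1 _ _ _ s t fun x => h (a * x),
    fun f c d h => m.2.2 _ c d fun x => h (a * x)⟩
  one_smul m := by
    refine Subtype.ext (funext fun f => congrArg m.1 (Subtype.ext (funext fun x => ?_)))
    exact congrArg f.1 (one_mul x)
  mul_smul a b m := by
    refine Subtype.ext (funext fun f => congrArg m.1 (Subtype.ext (funext fun x => ?_)))
    exact congrArg f.1 (mul_assoc a b x)

theorem meanSet_smul_apply (a : G) (m : meanSet G) (f : {f : G → ℝ // IsBUC f}) :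
    (a • m).1 f = m.1 (translateBUC G a f) := rfl

variable {G} in
omit [IsTopologicalGroup G] in
theorem meanSet_abs_sub_le (m : meanSet G) {f g : {f : G → ℝ // IsBUC f}} {ε : ℝ}
    (h : ∀ x, |f.1 x - g.1 x| ≤ ε) : |m.1 f - m.1 g| ≤ ε := by
  have hfg : IsBUC fun x => f.1 x + (-1) * g.1 x := f.2.add (g.2.const_mul _)
  have h1 := m.2.1 f g ⟨_, hfg⟩ 1 (-1) fun x => by simp
  have h2 := m.2.2 ⟨_, hfg⟩ (-ε) ε fun x => by
    have := abs_le.1 (h x)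
    constructor <;> simp only <;> linarith [this.1, this.2]
  rw [h1] at h2
  exact abs_le.2 ⟨by linarith [h2.1], by linarith [h2.2]⟩

/-- Joint continuity for the pointwise topology: translates of `f` vary continuously in the sup norm
because `f` is `IsBUC`, and all means are 1-Lipschitz for that norm. -/
instance : ContinuousSMul G (meanSet G) where
  continuous_smul := by
    refine Continuous.subtype_mk (continuous_pi fun f => ?_) _
    rw [continuous_iff_continuousAt]
    rintro ⟨a, m⟩
    rw [ContinuousAt, Metric.tendsto_nhds]
    intro ε hε
    have h1 : ∀ᶠ b in 𝓝 a, ∀ x, |f.1 (b * x) - f.1 (a * x)| ≤ ε / 2 := by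
      have h : Tendsto (fun b : G => b * a⁻¹) (𝓝 a) (𝓝 1) := by
        have h : Continuous fun b : G => b * a⁻¹ := by fun_prop
        simpa using h.tendsto a
      filter_upwards [h.eventually (f.2.2 (ε / 2) (half_pos hε))] with b hb x
      have := hb (a * x)
      rwa [show b * a⁻¹ * (a * x) = b * x by group] at this
    have h2 : ∀ᶠ m' in 𝓝 m, dist (m'.1 (translateBUC G a f)) (m.1 (translateBUC G a f)) < ε / 2 :=
      Metric.tendsto_nhds.1 (((continuous_apply (translateBUC G a f)).comp
        continuous_subtype_val).tendsto m) _ (half_pos hε)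
    rw [nhds_prod_eq]
    filter_upwards [h1.prod_mk h2] with p hp
    have h3 : dist (p.2.1 (translateBUC G p.1 f)) (p.2.1 (translateBUC G a f)) ≤ ε / 2 :=
      meanSet_abs_sub_le p.2 hp.1
    have h4 := dist_triangle (p.2.1 (translateBUC G p.1 f)) (p.2.1 (translateBUC G a f))
      (m.1 (translateBUC G a f))
    refine lt_of_le_of_lt h4 ?_
    linarith [hp.2, h3]

variable {G}

theorem AmenableTopGroup.exists_isInvariantMean (hG : AmenableTopGroup G) :
    ∃ M : (G → ℝ) → ℝ, IsInvariantMean M := by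
  classical
  obtain ⟨m, hm⟩ := hG ({f : G → ℝ // IsBUC f} → ℝ) (meanSet G) (isCompact_meanSet G)
    (convex_meanSet G) (nonempty_meanSet G) fun g x y z a b _ _ _ h => by
      ext f
      simp [meanSet_smul_apply, h]
  obtain ⟨M, key⟩ : ∃ M : (G → ℝ) → ℝ, ∀ {f : G → ℝ} (hf : IsBUC f), M f = m.1 ⟨f, hf⟩ :=
    ⟨fun f => if h : IsBUC f then m.1 ⟨f, h⟩ else 0, fun hf => dif_pos hf⟩
  refine ⟨M, ?_, ?_, ?_, ?_, ?_⟩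
  · intro f g hf hg
    rw [key hf, key hg, key (hf.add hg)]
    simpa using m.2.1 ⟨f, hf⟩ ⟨g, hg⟩ ⟨_, hf.add hg⟩ 1 1 (by simp)
  · intro f c hf
    rw [key hf, key (hf.const_mul c)]
    simpa using m.2.1 ⟨f, hf⟩ ⟨f, hf⟩ ⟨_, hf.const_mul c⟩ c 0 (by simp)
  · intro f c hf h
    rw [key hf]
    obtain ⟨C, hC⟩ := hf.1
    exact (m.2.2 ⟨f, hf⟩ (-C) c fun x => ⟨(abs_le.1 (hC x)).1, h x⟩).2
  · intro f c hf h
    rw [key hf]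
    obtain ⟨C, hC⟩ := hf.1
    exact (m.2.2 ⟨f, hf⟩ c C fun x => ⟨h x, (abs_le.1 (hC x)).2⟩).1
  · intro f a hf
    rw [key hf, key (hf.comp_mul_left a)]
    exact congrFun (congrArg Subtype.val (hm a)) ⟨f, hf⟩

end ExistsMean

/-! ### Calculus of means -/

namespace IsInvariantMean

variable {Γ : Type*} [Group Γ] [TopologicalSpace Γ] {M : (Γ → ℝ) → ℝ} {f g : Γ → ℝ}

theorem const (hM : IsInvariantMean M) (c : ℝ) : M (fun _ => c) = c :=
  le_antisymm (hM.le_of_forall_le (.const c) fun _ => le_rfl)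
    (hM.le_of_le_forall (.const c) fun _ => le_rfl)

theorem mono (hM : IsInvariantMean M) (hf : IsBUC f) (hg : IsBUC g) (h : ∀ x, f x ≤ g x) :
    M f ≤ M g := by
  have h1 := hM.le_of_le_forall (hg.add (hf.const_mul (-1))) (c := 0) fun x => by
    linarith [h x]
  rw [hM.add hg (hf.const_mul (-1)), hM.const_mul _ hf] at h1
  linarith

theorem abs_sub_le (hM : IsInvariantMean M) (hf : IsBUC f) (hg : IsBUC g) {ε : ℝ}
    (h : ∀ x, |f x - g x| ≤ ε) : |M f - M g| ≤ ε := by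
  have h1 := hM.mono hf (hg.add (.const ε)) fun x => by linarith [(abs_le.1 (h x)).2]
  have h2 := hM.mono hg (hf.add (.const ε)) fun x => by linarith [(abs_le.1 (h x)).1]
  rw [hM.add hg (.const ε), hM.const] at h1
  rw [hM.add hf (.const ε), hM.const] at h2
  exact abs_le.2 ⟨by linarith, by linarith⟩

/-- Expanding `(f x - a) ^ 2 ≤ c ^ 2` and averaging bounds the mean of the square by `2 * a * M f +
c ^ 2 - a ^ 2`, which is `M f ^ 2 + c ^ 2 - (M f - a) ^ 2`. -/
theorem mul_self_le (hM : IsInvariantMean M) (hf : IsBUC f) {a c : ℝ}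
    (h : ∀ x, |f x - a| ≤ c) : M (fun x => f x * f x) ≤ M f * M f + c ^ 2 := by
  have h1 := hM.mono (hf.mul hf) ((hf.const_mul (2 * a)).add (.const (c ^ 2 - a ^ 2)))
    fun x => by
      have := sq_le_sq' (abs_le.1 (h x)).1 (abs_le.1 (h x)).2
      linarith
  rw [hM.add (hf.const_mul _) (.const _), hM.const_mul _ hf, hM.const] at h1
  nlinarith [sq_nonneg (M f - a)]

theorem sum (hM : IsInvariantMean M) {κ : Type*} (s : Finset κ) {F : κ → Γ → ℝ}
    (h : ∀ k ∈ s, IsBUC (F k)) : M (fun x => ∑ k ∈ s, F k x) = ∑ k ∈ s, M (F k) := by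
  classical
  induction s using Finset.induction_on with
  | empty => simpa using hM.const 0
  | insert a s ha ih =>
    have hs : ∀ k ∈ s, IsBUC (F k) := fun k hk => h k (Finset.mem_insert_of_mem hk)
    simp only [Finset.sum_insert ha]
    rw [hM.add (h a (Finset.mem_insert_self _ _)) (.sum s hs), ih hs]

end IsInvariantMean

/-! ### Iterated means on finite powers and their variance -/

section PiMean

theorem eq_of_update_eq {ι α β : Type*} [DecidableEq ι] [Fintype ι] {F : (ι → α) → β}
    (h : ∀ i t g, F (Function.update t i g) = F t) (s t : ι → α) :
    F s = F t := by
  have key : ∀ S : Finset ι, F (S.piecewise s t) = F t := by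
    intro S
    induction S using Finset.induction_on with
    | empty => simp
    | insert a S _ ih => rw [Finset.piecewise_insert, h, ih]
  simpa using key Finset.univ

open Function

variable {G : Type*} [Group G] [TopologicalSpace G] {ι : Type*} [DecidableEq ι]

omit [TopologicalSpace G] in
theorem mul_update_eq (s t : ι → G) (i : ι) (g : G) :
    s * update t i g = update (s * t) i (s i * g) := by
  ext j
  rcases eq_or_ne j i with rfl | h <;> simp [*]

/-- Average a function on `ι → G` over the coordinate `i`. -/
def coordMean (M : (G → ℝ) → ℝ) (i : ι) (F : (ι → G) → ℝ) : (ι → G) → ℝ :=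
  fun t => M fun g => F (update t i g)

theorem IsBUC.slice {F : (ι → G) → ℝ} (hF : IsBUC F) (t : ι → G) (i : ι) :
    IsBUC fun g => F (update t i g) := by
  obtain ⟨⟨C, hC⟩, hF⟩ := hF
  refine ⟨⟨C, fun g => hC _⟩, fun ε hε => ?_⟩
  have h : Tendsto (fun u : G => (Pi.mulSingle i u : ι → G)) (𝓝 1) (𝓝 1) := by
    simpa using (continuous_mulSingle (A := fun _ : ι => G) i).tendsto 1
  filter_upwards [h.eventually (hF ε hε)] with u hu g
  have h2 : Pi.mulSingle i u * update t i g = update t i (u * g) := by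
    ext j
    rcases eq_or_ne j i with rfl | h <;> simp [*]
  rw [← h2]
  exact hu _

variable {M : (G → ℝ) → ℝ} {F F' : (ι → G) → ℝ}

/-- Coordinate `i` of the translation is absorbed by invariance of `M`; the others only move the
base point. -/
theorem coordMean_comp_mul_left (hM : IsInvariantMean M) (hF : IsBUC F) (i : ι) (s t : ι → G) :
    coordMean M i (fun x => F (s * x)) t = coordMean M i F (s * t) := by
  simp only [coordMean, mul_update_eq]
  exact hM.comp_mul_left (s i) (hF.slice (s * t) i)

theorem abs_coordMean_update_sub_le (hM : IsInvariantMean M) (hF : IsBUC F) (i j : ι) {c : ℝ}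
    (h : ∀ t g, |F (update t j g) - F t| ≤ c) (t : ι → G) (g : G) :
    |coordMean M i F (update t j g) - coordMean M i F t| ≤ c := by
  rcases eq_or_ne i j with rfl | hij
  · simpa [coordMean] using (abs_nonneg _).trans (h t g)
  · refine hM.abs_sub_le (hF.slice _ _) (hF.slice _ _) fun x => ?_
    rw [update_comm hij.symm]
    exact h _ _

/-- Average a function on `ι → G` over the coordinates in a list, the last one first. -/
def iterMean (M : (G → ℝ) → ℝ) (l : List ι) (F : (ι → G) → ℝ) : (ι → G) → ℝ :=
  l.foldr (coordMean M) F

omit [Group G] [TopologicalSpace G] in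
theorem iterMean_cons (i : ι) (l : List ι) :
    iterMean M (i :: l) F = coordMean M i (iterMean M l F) := rfl

variable [IsTopologicalGroup G]

theorem IsBUC.coordMean (hF : IsBUC F) (hM : IsInvariantMean M) (i : ι) :
    IsBUC (coordMean M i F) := by
  obtain ⟨C, hC⟩ := hF.1
  refine ⟨⟨C, fun t => abs_le.2 ⟨?_, ?_⟩⟩, fun ε hε => ?_⟩
  · exact hM.le_of_le_forall (hF.slice t i) fun g => (abs_le.1 (hC _)).1
  · exact hM.le_of_forall_le (hF.slice t i) fun g => (abs_le.1 (hC _)).2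
  · filter_upwards [hF.2 ε hε] with u hu t
    rw [← coordMean_comp_mul_left hM hF]
    exact hM.abs_sub_le ((hF.comp_mul_left u).slice t i) (hF.slice t i) fun g => hu _

theorem IsBUC.iterMean (hF : IsBUC F) (hM : IsInvariantMean M) (l : List ι) :
    IsBUC (iterMean M l F) := by
  induction l with
  | nil => exact hF
  | cons i l ih => exact ih.coordMean hM i

theorem abs_iterMean_update_sub_le (hM : IsInvariantMean M) (hF : IsBUC F) (l : List ι) (j : ι)
    {c : ℝ} (h : ∀ t g, |F (update t j g) - F t| ≤ c) (t : ι → G) (g : G) :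
    |iterMean M l F (update t j g) - iterMean M l F t| ≤ c := by
  induction l generalizing t g with
  | nil => exact h t g
  | cons i l ih => exact abs_coordMean_update_sub_le hM (hF.iterMean hM l) i j ih t g

/-- Averaging over `j` removes the dependence on `j`, and further averages keep it removed: this is
oscillation bound `c = 0`. -/
theorem iterMean_update_of_mem (hM : IsInvariantMean M) (hF : IsBUC F) {l : List ι} {j : ι}
    (hj : j ∈ l) (t : ι → G) (g : G) :
    iterMean M l F (update t j g) = iterMean M l F t := by
  induction l generalizing t g with
  | nil => simp at hj
  | cons i l ih =>
    rcases eq_or_ne i j with rfl | hij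
    · simp [iterMean_cons, coordMean]
    · have hj : j ∈ l := by simpa [hij.symm] using hj
      have := abs_coordMean_update_sub_le hM (hF.iterMean hM l) i j (c := 0)
        (fun t g => by simp [ih hj t g]) t g
      exact sub_eq_zero.1 (abs_nonpos_iff.1 this)

theorem iterMean_comp_mul_left (hM : IsInvariantMean M) (hF : IsBUC F) (l : List ι)
    (s : ι → G) : iterMean M l (fun x => F (s * x)) = fun t => iterMean M l F (s * t) := by
  induction l with
  | nil => rfl
  | cons i l ih =>
    rw [iterMean_cons, ih]
    exact funext fun t => coordMean_comp_mul_left hM (hF.iterMean hM l) i s t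

theorem iterMean_add (hM : IsInvariantMean M) (hF : IsBUC F) (hF' : IsBUC F') (l : List ι) :
    iterMean M l (fun x => F x + F' x) = fun t => iterMean M l F t + iterMean M l F' t := by
  induction l with
  | nil => rfl
  | cons i l ih =>
    rw [iterMean_cons, ih]
    exact funext fun t => hM.add ((hF.iterMean hM l).slice t i) ((hF'.iterMean hM l).slice t i)

theorem iterMean_const_mul (hM : IsInvariantMean M) (hF : IsBUC F) (c : ℝ) (l : List ι) :
    iterMean M l (fun x => c * F x) = fun t => c * iterMean M l F t := by
  induction l with
  | nil => rfl
  | cons i l ih =>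
    rw [iterMean_cons, ih]
    exact funext fun t => hM.const_mul c ((hF.iterMean hM l).slice t i)

theorem iterMean_le (hM : IsInvariantMean M) (hF : IsBUC F) {c : ℝ} (h : ∀ x, F x ≤ c)
    (l : List ι) (t : ι → G) : iterMean M l F t ≤ c := by
  induction l generalizing t with
  | nil => exact h t
  | cons i l ih => exact hM.le_of_forall_le ((hF.iterMean hM l).slice t i) fun g => ih _

theorem le_iterMean (hM : IsInvariantMean M) (hF : IsBUC F) {c : ℝ} (h : ∀ x, c ≤ F x)
    (l : List ι) (t : ι → G) : c ≤ iterMean M l F t := by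
  induction l generalizing t with
  | nil => exact h t
  | cons i l ih => exact hM.le_of_le_forall ((hF.iterMean hM l).slice t i) fun g => ih _

/-- Efron–Stein inequality for iterated means. -/
theorem iterMean_mul_self_le (hM : IsInvariantMean M) (hF : IsBUC F) {c : ι → ℝ}
    (h : ∀ i t g, |F (update t i g) - F t| ≤ c i) (l : List ι) (t : ι → G) :
    iterMean M l (fun x => F x * F x) t ≤
      iterMean M l F t * iterMean M l F t + (l.map fun i => c i ^ 2).sum := by
  induction l generalizing t with
  | nil => simp [iterMean]
  | cons i l ih =>
    have hb := (hF.iterMean hM l).slice t i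
    have h1 : coordMean M i (iterMean M l fun x => F x * F x) t ≤
        M fun g => iterMean M l F (update t i g) * iterMean M l F (update t i g) +
          (l.map fun i => c i ^ 2).sum :=
      hM.mono (((hF.mul hF).iterMean hM l).slice t i) ((hb.mul hb).add (.const _)) fun g => ih _
    rw [hM.add (hb.mul hb) (.const _), hM.const] at h1
    -- The averages over `l` have not increased the oscillation in coordinate `i`, so the
    -- one-variable variance bound costs only `c i ^ 2`.
    have h2 := hM.mul_self_le hb (a := iterMean M l F t) (c := c i)
      fun g => abs_iterMean_update_sub_le hM hF l i (h i) t g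
    rw [iterMean_cons, iterMean_cons, List.map_cons, List.sum_cons]
    unfold coordMean at h1 ⊢
    linarith

/-- After averaging over all coordinates the result is constant, so the base point `1` is
immaterial; this is what makes the iterated mean invariant. -/
theorem IsInvariantMean.exists_pi [Fintype ι] (hM : IsInvariantMean M) :
    ∃ N : ((ι → G) → ℝ) → ℝ, IsInvariantMean N ∧ ∀ (F : (ι → G) → ℝ) (c : ι → ℝ), IsBUC F →
      (∀ i t g, |F (update t i g) - F t| ≤ c i) →
      N (fun x => F x * F x) ≤ N F * N F + ∑ i, c i ^ 2 := by
  refine ⟨fun F => iterMean M Finset.univ.toList F 1, ⟨?_, ?_, ?_, ?_, ?_⟩, ?_⟩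
  · exact fun hf hg => congrFun (iterMean_add hM hf hg _) 1
  · exact fun c hf => congrFun (iterMean_const_mul hM hf c _) 1
  · exact fun hf h => iterMean_le hM hf h _ _
  · exact fun hf h => le_iterMean hM hf h _ _
  · intro f a hf
    rw [iterMean_comp_mul_left hM hf]
    exact eq_of_update_eq (fun i t g => iterMean_update_of_mem hM hf (by simp) t g) _ _
  · intro F c hF h
    simpa using iterMean_mul_self_le hM hF h Finset.univ.toList 1

end PiMean

/-! ### Concentration for the weighted Hamming distance -/

section Concentration

open Function

variable {G : Type*} [Group G] {ι : Type*} [Fintype ι]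

open Classical in
/-- The total weight of the coordinates in which `s` differs from the identity. -/
noncomputable def hammingWeight (a : ι → ℝ) (s : ι → G) : ℝ := ∑ i, if s i = 1 then 0 else a i

variable {a : ι → ℝ}

theorem hammingWeight_nonneg (ha : ∀ i, 0 ≤ a i) (s : ι → G) : 0 ≤ hammingWeight a s :=
  Finset.sum_nonneg fun i _ => by split_ifs <;> simp [ha i]

theorem hammingWeight_one : hammingWeight a (1 : ι → G) = 0 := by
  simp [hammingWeight]

theorem hammingWeight_conj (u s : ι → G) : hammingWeight a (u * s * u⁻¹) = hammingWeight a s := by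
  classical
  have h : ∀ i, (u * s * u⁻¹) i = 1 ↔ s i = 1 := fun i => conj_eq_one_iff
  exact Finset.sum_congr rfl fun i _ => if_congr (h i) rfl rfl

theorem hammingWeight_mul_mulSingle_le [DecidableEq ι] (ha : ∀ i, 0 ≤ a i) (s : ι → G) (i : ι)
    (g : G) : hammingWeight a (s * Pi.mulSingle i g) ≤ hammingWeight a s + a i := by
  classical
  have h : ∑ j, (if j = i then a i else 0) = a i := by simp
  rw [hammingWeight, hammingWeight, ← h, ← Finset.sum_add_distrib]
  refine Finset.sum_le_sum fun j _ => ?_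
  rcases eq_or_ne j i with rfl | hj
  · have := ha j
    simp only [if_true]
    split_ifs <;> linarith
  · simp [hj]

/-- The largest function below `F` which is `L`-Lipschitz for the weighted Hamming distance. -/
noncomputable def lipschitzEnvelope (a : ι → ℝ) (L : ℝ) (F : (ι → G) → ℝ) (t : ι → G) : ℝ :=
  ⨅ s : ι → G, (F (s * t) + L * hammingWeight a s)

variable {F : (ι → G) → ℝ} {C L : ℝ}

theorem neg_le_add_hammingWeight (ha : ∀ i, 0 ≤ a i) (hL : 0 ≤ L) (hC : ∀ t, |F t| ≤ C)
    (t s : ι → G) : -C ≤ F (s * t) + L * hammingWeight a s := by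
  have := mul_nonneg hL (hammingWeight_nonneg ha s)
  linarith [(abs_le.1 (hC (s * t))).1]

theorem lipschitzEnvelope_le_add (ha : ∀ i, 0 ≤ a i) (hL : 0 ≤ L) (hC : ∀ t, |F t| ≤ C)
    (t s : ι → G) : lipschitzEnvelope a L F t ≤ F (s * t) + L * hammingWeight a s :=
  ciInf_le ⟨-C, forall_mem_range.2 (neg_le_add_hammingWeight ha hL hC t)⟩ s

theorem lipschitzEnvelope_le (ha : ∀ i, 0 ≤ a i) (hL : 0 ≤ L) (hC : ∀ t, |F t| ≤ C)
    (t : ι → G) : lipschitzEnvelope a L F t ≤ F t := by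
  simpa [hammingWeight_one] using lipschitzEnvelope_le_add ha hL hC t 1

/-- The constant `2 * C / δ` is chosen so that once the weight of `s` reaches `δ` the penalty
outweighs the total oscillation `2 * C` of `F`; below `δ` the hypothesis on `F` applies. -/
theorem sub_le_lipschitzEnvelope (ha : ∀ i, 0 ≤ a i) (hC : ∀ t, |F t| ≤ C)
    {δ ε : ℝ} (hδ : 0 < δ) (hε : 0 ≤ ε)
    (hF : ∀ s, hammingWeight a s < δ → ∀ t, |F (s * t) - F t| ≤ ε) (t : ι → G) :
    F t - ε ≤ lipschitzEnvelope a (2 * C / δ) F t := by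
  have hC0 : 0 ≤ C := (abs_nonneg _).trans (hC 1)
  refine le_ciInf fun s => ?_
  rcases lt_or_ge (hammingWeight a s) δ with h | h
  · have h1 := (abs_le.1 (hF s h t)).1
    have h2 : 0 ≤ 2 * C / δ * hammingWeight a s :=
      mul_nonneg (by positivity) (hammingWeight_nonneg ha s)
    linarith
  · have h1 : 2 * C ≤ 2 * C / δ * hammingWeight a s := by
      rw [div_mul_eq_mul_div, le_div_iff₀ hδ]
      gcongr
    linarith [(abs_le.1 (hC t)).2, (abs_le.1 (hC (s * t))).1]

theorem abs_lipschitzEnvelope_update_sub_le [DecidableEq ι] (ha : ∀ i, 0 ≤ a i) (hL : 0 ≤ L)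
    (hC : ∀ t, |F t| ≤ C) (i : ι) (t : ι → G) (g : G) :
    |lipschitzEnvelope a L F (update t i g) - lipschitzEnvelope a L F t| ≤ L * a i := by
  have key : ∀ (t : ι → G) (b : G),
      lipschitzEnvelope a L F t ≤ lipschitzEnvelope a L F (Pi.mulSingle i b * t) + L * a i := by
    intro t b
    rw [← sub_le_iff_le_add]
    refine le_ciInf fun s => ?_
    have h1 := lipschitzEnvelope_le_add ha hL hC t (s * Pi.mulSingle i b)
    have h2 := mul_le_mul_of_nonneg_left (hammingWeight_mul_mulSingle_le ha s i b) hL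
    rw [mul_assoc] at h1
    linarith
  have h1 : update t i g = Pi.mulSingle i (g * (t i)⁻¹) * t := by
    ext j
    rcases eq_or_ne j i with rfl | h <;> simp [*]
  have h2 : t = Pi.mulSingle i (t i * g⁻¹) * update t i g := by
    ext j
    rcases eq_or_ne j i with rfl | h <;> simp [*]
  have h3 := key t (g * (t i)⁻¹)
  have h4 := key (update t i g) (t i * g⁻¹)
  rw [← h1] at h3
  rw [← h2] at h4
  exact abs_le.2 ⟨by linarith, by linarith⟩

/-- Conjugating the infimum variable by `u` moves the translation outside; the Hamming weight is
conjugation invariant, so the estimates for `F` pass to the envelope unchanged. -/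
theorem IsBUC.lipschitzEnvelope [TopologicalSpace G] (hF : IsBUC F)
    (ha : ∀ i, 0 ≤ a i) (hL : 0 ≤ L) : IsBUC (lipschitzEnvelope a L F) := by
  obtain ⟨C, hC⟩ := hF.1
  refine ⟨⟨C, fun t => abs_le.2 ⟨?_, ?_⟩⟩, fun ε hε => ?_⟩
  · exact le_ciInf fun s => neg_le_add_hammingWeight ha hL hC t s
  · exact (lipschitzEnvelope_le ha hL hC t).trans (abs_le.1 (hC t)).2
  · filter_upwards [hF.2 ε hε] with u hu t
    refine abs_le.2 ⟨?_, ?_⟩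
    · rw [neg_le_sub_iff_le_add, ← sub_le_iff_le_add]
      refine le_ciInf fun s => ?_
      have h1 := lipschitzEnvelope_le_add ha hL hC t (u⁻¹ * s * u)
      have h2 := (abs_le.1 (hu (u⁻¹ * s * u * t))).1
      have h3 := hammingWeight_conj (a := a) u⁻¹ s
      rw [inv_inv] at h3
      rw [h3] at h1
      rw [show u * (u⁻¹ * s * u * t) = s * (u * t) by group] at h2
      linarith
    · rw [sub_le_iff_le_add, ← sub_le_iff_le_add']
      refine le_ciInf fun s => ?_
      have h1 := lipschitzEnvelope_le_add ha hL hC (u * t) (u * s * u⁻¹)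
      have h2 := (abs_le.1 (hu (s * t))).2
      rw [hammingWeight_conj] at h1
      rw [show u * s * u⁻¹ * (u * t) = u * (s * t) by group] at h1
      linarith

/-- A second-moment argument: `E k` and its translate by `s k` have the same mean and small
variance, so for some `t` all of them are within `ε` of their means at once. Passing between `F k`
and `E k` costs at most another `ε` at each point. -/
theorem IsInvariantMean.exists_almost_fixed [TopologicalSpace G] [IsTopologicalGroup G]
    {M : (G → ℝ) → ℝ} (hM : IsInvariantMean M) {κ : Type*} [Fintype κ]
    (F : κ → (ι → G) → ℝ) (hF : ∀ k, IsBUC (F k)) (hC : ∀ k t, |F k t| ≤ C)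
    (ha : ∀ i, 0 ≤ a i) {δ ε : ℝ} (hδ : 0 < δ) (hε : 0 < ε)
    (hFδ : ∀ k s, hammingWeight a s < δ → ∀ t, |F k (s * t) - F k t| ≤ ε)
    (hsmall : Fintype.card κ * (2 * ((2 * C / δ) ^ 2 * ∑ i, a i ^ 2)) < ε ^ 2)
    (s : κ → ι → G) : ∃ t, ∀ k, |F k (s k * t) - F k t| ≤ 4 * ε := by
  classical
  rcases isEmpty_or_nonempty κ with hκ | ⟨⟨k₀⟩⟩
  · exact ⟨1, fun k => hκ.elim k⟩
  have hC0 : 0 ≤ C := (abs_nonneg _).trans (hC k₀ 1)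
  obtain ⟨N, hN, hvar⟩ := hM.exists_pi (ι := ι)
  set K : ℝ := 2 * C / δ
  have hK0 : 0 ≤ K := by positivity
  let E : κ → (ι → G) → ℝ := fun k => lipschitzEnvelope a K (F k)
  have hE : ∀ k, IsBUC (E k) := fun k => (hF k).lipschitzEnvelope ha hK0
  have hEdiff : ∀ k i t g, |E k (update t i g) - E k t| ≤ K * a i := fun k i t g =>
    abs_lipschitzEnvelope_update_sub_le ha hK0 (hC k) i t g
  -- deviation of a translate of `E k` from the mean of `E k`
  let D : κ → (ι → G) → (ι → G) → ℝ := fun k s t => E k (s * t) + -N (E k)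
  have hD : ∀ k s, IsBUC (D k s) := fun k s => ((hE k).comp_mul_left s).add (.const _)
  have hDN : ∀ k s, N (D k s) = 0 := fun k s => by
    rw [hN.add ((hE k).comp_mul_left s) (.const _), hN.const, hN.comp_mul_left s (hE k)]
    ring
  have hDvar : ∀ k s, N (fun t => D k s t * D k s t) ≤ K ^ 2 * ∑ i, a i ^ 2 := by
    intro k s
    have h := hvar (D k s) (fun i => K * a i) (hD k s) fun i t g => by
      have := hEdiff k i (s * t) (s i * g)
      rw [← mul_update_eq] at this
      simpa [D] using this
    rw [hDN] at h
    simpa [mul_pow, Finset.mul_sum] using h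
  -- By `hsmall` the mean of this sum is below `ε ^ 2`, so the sum cannot be at least `ε ^ 2`
  -- everywhere.
  obtain ⟨t, ht⟩ : ∃ t, ∑ k, (D k (s k) t * D k (s k) t + D k 1 t * D k 1 t) < ε ^ 2 := by
    by_contra! hcon
    have h1 := hN.le_of_le_forall (.sum Finset.univ fun k _ =>
      ((hD k (s k)).mul (hD k (s k))).add ((hD k 1).mul (hD k 1))) hcon
    rw [hN.sum _ fun k _ => ((hD k (s k)).mul (hD k (s k))).add ((hD k 1).mul (hD k 1))] at h1
    have h2 : ∀ k ∈ Finset.univ,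
        N (fun t => D k (s k) t * D k (s k) t + D k 1 t * D k 1 t) ≤
          2 * (K ^ 2 * ∑ i, a i ^ 2) := fun k _ => by
      rw [hN.add ((hD k (s k)).mul (hD k (s k))) ((hD k 1).mul (hD k 1))]
      linarith [hDvar k (s k), hDvar k 1]
    have h3 := Finset.sum_le_card_nsmul _ _ _ h2
    rw [nsmul_eq_mul, Finset.card_univ] at h3
    linarith
  refine ⟨t, fun k => ?_⟩
  have h1 : D k (s k) t * D k (s k) t + D k 1 t * D k 1 t < ε ^ 2 :=
    (Finset.single_le_sum (f := fun k => D k (s k) t * D k (s k) t + D k 1 t * D k 1 t)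
      (fun k _ => add_nonneg (mul_self_nonneg _) (mul_self_nonneg _))
      (Finset.mem_univ k)).trans_lt ht
  have h2 := abs_lt.1 (abs_lt_of_sq_lt_sq
    (by nlinarith [mul_self_nonneg (D k 1 t)] : D k (s k) t ^ 2 < ε ^ 2) hε.le)
  have h3 := abs_lt.1 (abs_lt_of_sq_lt_sq
    (by nlinarith [mul_self_nonneg (D k (s k) t)] : D k 1 t ^ 2 < ε ^ 2) hε.le)
  simp only [D, one_mul] at h2 h3
  have u1 : E k (s k * t) ≤ F k (s k * t) := lipschitzEnvelope_le ha hK0 (hC k) _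
  have u2 : E k t ≤ F k t := lipschitzEnvelope_le ha hK0 (hC k) _
  have l1 : F k (s k * t) - ε ≤ E k (s k * t) :=
    sub_le_lipschitzEnvelope ha (hC k) hδ hε.le (hFδ k) _
  have l2 : F k t - ε ≤ E k t := sub_le_lipschitzEnvelope ha (hC k) hδ hε.le (hFδ k) _
  exact abs_le.2 ⟨by linarith, by linarith⟩

end Concentration

/-! ### Fixed points from almost fixed points -/

section FixedPoint

variable {H : Type*} [Group H] [TopologicalSpace H] {Y : Type*} [TopologicalSpace Y]
  [CompactSpace Y] [MulAction H Y] [ContinuousSMul H Y]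

theorem eventually_forall_abs_smul_sub_lt (f : C(Y, ℝ)) {ε : ℝ} (hε : 0 < ε) :
    ∀ᶠ u in 𝓝 (1 : H), ∀ y : Y, |f (u • y) - f y| < ε := by
  have h := isCompact_univ.eventually_forall_of_forall_eventually (x₀ := (1 : H))
    (P := fun (u : H) (y : Y) => |f (u • y) - f y| < ε) fun y _ => by
      have hc : Continuous fun z : H × Y => |f (z.1 • z.2) - f z.2| := by fun_prop
      exact (hc.tendsto (1, y)).eventually_lt_const (by simpa using hε)
  simpa using h

theorem exists_fixedPoint_of_almost_fixed [T2Space Y]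
    (h : ∀ P : Finset (C(Y, ℝ) × H), ∃ z : Y, ∀ p ∈ P, |p.1 (p.2 • z) - p.1 z| ≤ 1) :
    ∃ x : Y, ∀ a : H, a • x = x := by
  obtain ⟨x, hx⟩ := CompactSpace.iInter_nonempty
    (t := fun p : C(Y, ℝ) × H => {z : Y | |p.1 (p.2 • z) - p.1 z| ≤ 1})
    (fun p => isClosed_le (by fun_prop) continuous_const) fun P => by
      obtain ⟨z, hz⟩ := h P
      exact ⟨z, mem_iInter₂.2 hz⟩
  refine ⟨x, fun a => ?_⟩
  by_contra hne
  obtain ⟨f, hf0, hf1, -⟩ := exists_continuous_zero_one_of_isClosed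
    (isClosed_singleton (x := x)) (isClosed_singleton (x := a • x)) (by simpa [eq_comm] using hne)
  -- Doubling the Urysohn function makes it jump by 2 between `x` and `a • x`, beyond the tolerance
  -- 1.
  have h1 := mem_iInter.1 hx ((2 : ℝ) • f, a)
  have h2 : f x = 0 := hf0 rfl
  have h3 : f (a • x) = 1 := hf1 rfl
  simp [h2, h3] at h1

end FixedPoint

/-! ### Partitions into small pieces -/

section Partition

variable {X : Type*} [MeasurableSpace X] {μ : Measure X}

theorem volume_unitInterval_floor_le {N : ℕ} (hN : 0 < N) (k : ℕ) :
    volume {t : unitInterval | ⌊(N : ℝ) * t⌋₊ = k} ≤ ENNReal.ofReal (1 / N) := by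
  have hN' : (0 : ℝ) < N := Nat.cast_pos.2 hN
  rw [unitInterval.volume_apply]
  refine (measure_mono (t := Ico ((k : ℝ) / N) ((k + 1) / N)) ?_).trans_eq ?_
  · rintro _ ⟨t, ht, rfl⟩
    obtain ⟨h1, h2⟩ := (Nat.floor_eq_iff (mul_nonneg hN'.le t.2.1)).1 ht
    exact ⟨(div_le_iff₀' hN').2 h1, (lt_div_iff₀' hN').2 h2⟩
  · rw [Real.volume_Ico]
    congr 1
    field_simp
    ring

theorem IsNonatomicLebesgueSpace.exists_simpleFunc_fiber_le (hμ : IsNonatomicLebesgueSpace μ)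
    {N : ℕ} (hN : 0 < N) :
    ∃ q : SimpleFunc X ℕ, ∀ k, μ (q ⁻¹' {k}) ≤ ENNReal.ofReal (1 / N) := by
  obtain ⟨φ, -, hφ, -, hpres, -⟩ := hμ
  have hφ' := hφ.aemeasurable
  have hm : Measurable fun t : unitInterval => ⌊(N : ℝ) * t⌋₊ :=
    Nat.measurable_floor.comp (measurable_const.mul measurable_subtype_coe)
  -- The pieces are preimages of intervals of length `1 / N`; a measurable representative of `φ`
  -- makes them measurable.
  refine ⟨⟨fun x => ⌊(N : ℝ) * hφ'.mk φ x⌋₊, fun k => ?_, ?_⟩, fun k => ?_⟩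
  · exact hm.comp hφ'.measurable_mk (measurableSet_singleton k)
  · refine (finite_Iic N).subset (range_subset_iff.2 fun x => ?_)
    refine Nat.floor_le_of_le ?_
    exact mul_le_of_le_one_right (Nat.cast_nonneg _) (hφ'.mk φ x).2.2
  · refine le_trans (le_of_eq ?_) (volume_unitInterval_floor_le hN k)
    refine Eq.trans (measure_congr ?_) (hpres _ (hm (measurableSet_singleton k)))
    filter_upwards [hφ'.ae_eq_mk] with x hx
    change (⌊(N : ℝ) * hφ'.mk φ x⌋₊ = k) = (⌊(N : ℝ) * φ x⌋₊ = k)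
    rw [hx]

/-- Finitely many simple functions factor through a finite partition into small sets. -/
theorem IsNonatomicLebesgueSpace.exists_common_partition (hμ : IsNonatomicLebesgueSpace μ)
    {G : Type u} {κ : Type v} [Finite κ] (s : κ → SimpleFunc X G) {N : ℕ} (hN : 0 < N) :
    ∃ (ι : Type max u v) (_ : Fintype ι) (S : SimpleFunc X ι) (t : κ → ι → G),
      (∀ k x, t k (S x) = s k x) ∧ ∀ i, μ (S ⁻¹' {i}) ≤ ENNReal.ofReal (1 / N) := by
  obtain ⟨q, hq⟩ := hμ.exists_simpleFunc_fiber_le hN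
  -- Recording all values together with the cell index `q x` gives the common refinement; its range
  -- indexes the pieces.
  let T : X → (κ → G) × ℕ := fun x => (fun k => s k x, q x)
  have hT : (range T).Finite := by
    refine ((Set.Finite.pi' fun k => (s k).finite_range).prod q.finite_range).subset ?_
    rintro _ ⟨x, rfl⟩
    exact ⟨fun k => mem_range_self x, mem_range_self x⟩
  have hTm : ∀ c, MeasurableSet (T ⁻¹' {c}) := fun c => by
    have : T ⁻¹' {c} = (⋂ k, s k ⁻¹' {c.1 k}) ∩ q ⁻¹' {c.2} := by
      ext x
      simp [T, Prod.ext_iff, funext_iff]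
    rw [this]
    exact (MeasurableSet.iInter fun k => (s k).measurableSet_fiber _).inter
      (q.measurableSet_fiber _)
  have hfib : ∀ i : range T, (fun x => (⟨T x, mem_range_self x⟩ : range T)) ⁻¹' {i} =
      T ⁻¹' {i.1} := fun i => by
    ext x
    simp [Subtype.ext_iff]
  refine ⟨range T, hT.fintype, ⟨fun x => ⟨T x, mem_range_self x⟩, fun i => ?_, ?_⟩,
    fun k i => i.1.1 k, fun k x => rfl, fun i => ?_⟩
  · rw [hfib]
    exact hTm i
  · have := hT.to_subtype
    exact toFinite _
  · refine (measure_mono ?_).trans (hq i.1.2)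
    intro x hx
    exact congrArg (fun i : range T => i.1.2) hx

end Partition

/-! ### Step functions and extreme amenability -/

namespace HartmanMycielski

variable {X : Type*} [MeasurableSpace X] {μ : Measure X}
  {G : Type*} [Group G] [TopologicalSpace G] [IsTopologicalGroup G] {ι : Type*}

/-- The homomorphism sending `t : ι → G` to the step function with value `t i` on the piece `i` of
a finite partition. -/
noncomputable def stepHom (μ : Measure X) (G : Type*) [Group G] [TopologicalSpace G]
    [IsTopologicalGroup G] (S : SimpleFunc X ι) : (ι → G) →* (X →ₘ[μ] G) :=
  MonoidHom.mk' (fun t => AEEqFun.mk (S.map t) (S.map t).aestronglyMeasurable) fun _ _ => rfl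

theorem coeFn_stepHom (S : SimpleFunc X ι) (t : ι → G) :
    stepHom μ G S t =ᵐ[μ] fun x => t (S x) :=
  AEEqFun.coeFn_mk _ _

theorem exists_basicNhd_subset [IsFiniteMeasure μ] {U : Set (X →ₘ[μ] G)} (hU : U ∈ 𝓝 1) :
    ∃ V ∈ 𝓝 (1 : G), ∃ ε : ℝ≥0∞, 0 < ε ∧ basicNhd μ V ε ⊆ U := by
  obtain ⟨_, ⟨V, hV, ε, hε, rfl⟩, h⟩ := ((basis μ G).nhds_one_hasBasis).mem_iff.1 hU
  exact ⟨V, hV, ε, hε, h⟩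

theorem continuous_stepHom [IsFiniteMeasure μ] [Finite ι] (S : SimpleFunc X ι) :
    Continuous (stepHom μ G S) := by
  refine continuous_of_continuousAt_one _ fun U hU => ?_
  rw [map_one] at hU
  obtain ⟨V, hV, ε, hε, hVU⟩ := exists_basicNhd_subset hU
  have h : ∀ᶠ t in 𝓝 (1 : ι → G), ∀ i, t i ∈ V :=
    eventually_all.2 fun i => (continuous_apply i).continuousAt.eventually hV
  refine mem_map.2 (h.mono fun t ht => ?_)
  refine hVU (lt_of_eq_of_lt ?_ hε)
  change ∀ᵐ x ∂μ, stepHom μ G S t x ∈ V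
  filter_upwards [coeFn_stepHom S t] with x hx
  rw [hx]
  exact ht _

omit [TopologicalSpace G] [IsTopologicalGroup G] in
theorem measure_ne_one_le_hammingWeight [IsFiniteMeasure μ] [Fintype ι] (S : SimpleFunc X ι)
    (t : ι → G) : μ {x | t (S x) ≠ 1} ≤
      ENNReal.ofReal (hammingWeight (fun i => μ.real (S ⁻¹' {i})) t) := by
  classical
  have h : {x | t (S x) ≠ 1} ⊆ ⋃ i ∈ Finset.univ.filter fun i => t i ≠ 1, S ⁻¹' {i} := by
    intro x hx
    simpa using hx
  refine (measure_mono h).trans ((measure_biUnion_finset_le _ _).trans_eq ?_)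
  rw [hammingWeight, ENNReal.ofReal_sum_of_nonneg fun i _ => by
    split_ifs <;> simp [measureReal_nonneg], Finset.sum_filter]
  refine Finset.sum_congr rfl fun i _ => ?_
  by_cases hi : t i = 1 <;> simp [hi]

/-- Off a set of measure at most the Hamming weight the step function equals `1`, so smallness of
the weight suffices whatever `V` is. -/
theorem stepHom_mem_basicNhd [IsFiniteMeasure μ] [Fintype ι] (S : SimpleFunc X ι) {V : Set G}
    (hV : V ∈ 𝓝 (1 : G)) {ε : ℝ≥0∞} {t : ι → G}
    (ht : ENNReal.ofReal (hammingWeight (fun i => μ.real (S ⁻¹' {i})) t) < ε) :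
    stepHom μ G S t ∈ basicNhd μ V ε := by
  refine lt_of_le_of_lt (measure_mono_ae ?_) ((measure_ne_one_le_hammingWeight S t).trans_lt ht)
  filter_upwards [coeFn_stepHom S t] with x hx hxV h
  refine hxV ?_
  rw [hx, show t (S x) = 1 from h]
  exact mem_of_mem_nhds hV

theorem mul_inv_stepHom_mem_basicNhd (S : SimpleFunc X ι) {V : Set G} {ε : ℝ≥0∞}
    {h : X →ₘ[μ] G} {s : SimpleFunc X G} (hs : μ {x | h x * (s x)⁻¹ ∉ V} < ε) {t : ι → G}
    (ht : ∀ x, t (S x) = s x) : h * (stepHom μ G S t)⁻¹ ∈ basicNhd μ V ε := by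
  refine lt_of_le_of_lt (measure_mono_ae ?_) hs
  filter_upwards [AEEqFun.coeFn_mul h (stepHom μ G S t)⁻¹, AEEqFun.coeFn_inv (stepHom μ G S t),
    coeFn_stepHom S t] with x h1 h2 h3 hxV hx
  refine hxV ?_
  rw [h1, Pi.mul_apply, h2, Pi.inv_apply, h3, ht]
  exact hx

theorem sum_measureReal_fiber_sq_le [IsProbabilityMeasure μ] [Fintype ι] (S : SimpleFunc X ι)
    {η : ℝ} (hη : 0 ≤ η) (h : ∀ i, μ (S ⁻¹' {i}) ≤ ENNReal.ofReal η) :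
    ∑ i, μ.real (S ⁻¹' {i}) ^ 2 ≤ η := by
  classical
  have h1 : ∑ i, μ.real (S ⁻¹' {i}) = 1 := by
    have := sum_measureReal_preimage_singleton (μ := μ) Finset.univ (f := S)
      fun i _ => S.measurableSet_fiber i
    simpa using this
  calc ∑ i, μ.real (S ⁻¹' {i}) ^ 2 ≤ ∑ i, η * μ.real (S ⁻¹' {i}) := by
        refine Finset.sum_le_sum fun i _ => ?_
        rw [sq]
        exact mul_le_mul_of_nonneg_right (ENNReal.toReal_le_of_le_ofReal hη (h i))
          measureReal_nonneg
    _ = η := by rw [← Finset.mul_sum, h1, mul_one]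

theorem extremelyAmenable_of_isInvariantMean {M : (G → ℝ) → ℝ} (hM : IsInvariantMean M)
    [IsProbabilityMeasure μ] (hμ : IsNonatomicLebesgueSpace μ) :
    ExtremelyAmenable.{_, v} (X →ₘ[μ] G) := by
  intro Y _ _ _ ⟨y₀⟩ _ _
  refine exists_fixedPoint_of_almost_fixed fun P => ?_
  -- The tolerance 1 is split as `4 * (1 / 5)` from `exists_almost_fixed` plus `1 / 5` for replacing
  -- `p.2` by a step function.
  have hU : ∀ᶠ u in 𝓝 (1 : X →ₘ[μ] G), ∀ p : P, ∀ y : Y,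
      |p.1.1 (u • y) - p.1.1 y| < (1 / 5 : ℝ) :=
    eventually_all.2 fun p => eventually_forall_abs_smul_sub_lt p.1.1 (by norm_num)
  obtain ⟨V, hV, ε₀, hε₀, hVU⟩ := exists_basicNhd_subset hU
  choose s hs using fun p : P => exists_simple p.1.2 hV hε₀
  set C : ℝ := ∑ p : P, ‖p.1.1‖
  have hfC : ∀ (p : P) (y : Y), |p.1.1 y| ≤ C := fun p y =>
    (p.1.1.norm_coe_le_norm y).trans
      (Finset.single_le_sum (f := fun p : P => ‖p.1.1‖) (fun _ _ => norm_nonneg _)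
        (Finset.mem_univ p))
  -- Truncation at 1 keeps `δ` finite, since `ε₀` may be infinite.
  set δ : ℝ := (min ε₀ 1).toReal
  have hδtop : min ε₀ 1 ≠ ∞ := ne_top_of_le_ne_top ENNReal.one_ne_top (min_le_right _ _)
  have hδ0 : 0 < δ := ENNReal.toReal_pos (lt_min hε₀ one_pos).ne' hδtop
  obtain ⟨N, hN⟩ := exists_nat_gt
    (max 0 (Fintype.card P * (2 * (2 * C / δ) ^ 2) / (1 / 5) ^ 2))
  have hN0 : (0 : ℝ) < N := (le_max_left _ _).trans_lt hN
  obtain ⟨ι, _, S, t, htS, hS⟩ :=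
    hμ.exists_common_partition s (Nat.cast_pos.1 hN0)
  set e := stepHom μ G S
  have hsmall : Fintype.card P * (2 * ((2 * C / δ) ^ 2 * ∑ i, μ.real (S ⁻¹' {i}) ^ 2)) <
      (1 / 5 : ℝ) ^ 2 := by
    have h1 := sum_measureReal_fiber_sq_le S (by positivity) hS
    have h2 := (div_lt_iff₀ (by norm_num)).1 ((le_max_right _ _).trans_lt hN)
    calc Fintype.card P * (2 * ((2 * C / δ) ^ 2 * ∑ i, μ.real (S ⁻¹' {i}) ^ 2))
        ≤ Fintype.card P * (2 * ((2 * C / δ) ^ 2 * (1 / N))) := by gcongr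
      _ = Fintype.card P * (2 * (2 * C / δ) ^ 2) / N := by ring
      _ < (1 / 5 : ℝ) ^ 2 := by
        rw [div_lt_iff₀ hN0]
        linarith
  obtain ⟨r, hr⟩ := hM.exists_almost_fixed (a := fun i => μ.real (S ⁻¹' {i}))
    (F := fun (p : P) (r : ι → G) => p.1.1 (e r • y₀)) (C := C) (δ := δ) (ε := 1 / 5)
    (fun p => ⟨⟨C, fun r => hfC p _⟩, fun ε hε => by
      have h := (continuous_stepHom (μ := μ) (G := G) S).tendsto 1
      rw [map_one] at h
      filter_upwards [h.eventually (eventually_forall_abs_smul_sub_lt p.1.1 hε)] with u hu r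
      rw [map_mul, mul_smul]
      exact (hu _).le⟩)
    (fun p r => hfC p _) (fun i => measureReal_nonneg) hδ0 (by norm_num)
    (fun p u hu r => by
      rw [map_mul, mul_smul]
      refine (hVU (stepHom_mem_basicNhd S hV ?_) p _).le
      refine lt_of_lt_of_le ?_ (min_le_left ε₀ 1)
      rw [← ENNReal.ofReal_toReal hδtop]
      exact (ENNReal.ofReal_lt_ofReal_iff hδ0).2 hu)
    hsmall t
  refine ⟨e r • y₀, fun p hp => ?_⟩
  have h1 := hr ⟨p, hp⟩
  have h2 : |p.1 ((p.2 * (e (t ⟨p, hp⟩))⁻¹) • e (t ⟨p, hp⟩ * r) • y₀) -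
      p.1 (e (t ⟨p, hp⟩ * r) • y₀)| < 1 / 5 :=
    hVU (mul_inv_stepHom_mem_basicNhd S (hs ⟨p, hp⟩) (htS ⟨p, hp⟩)) ⟨p, hp⟩ _
  -- Writing `p.2` as `(p.2 * (e t)⁻¹) * e t`, with `t` its step approximation, makes the first
  -- factor an element of the neighbourhood that hardly changes the functions in `P`.
  rw [map_mul, mul_smul (e (t ⟨p, hp⟩)), smul_smul _ (e (t ⟨p, hp⟩)), inv_mul_cancel_right] at h2
  simp only [map_mul, mul_smul] at h1
  have h1 := abs_le.1 h1
  have h2 := abs_lt.1 h2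
  exact abs_le.2 ⟨by linarith, by linarith⟩

end HartmanMycielski

theorem theorem2p2 {G : Type u} [Group G] [TopologicalSpace G] [IsTopologicalGroup G]
    [T2Space G] [LocallyCompactSpace G] (hG : AmenableTopGroup G)
    {X : Type w} [MeasurableSpace X] (μ : Measure X) [IsProbabilityMeasure μ]
    (hμ : IsNonatomicLebesgueSpace μ) :
    ExtremelyAmenable.{max u w, v} (X →ₘ[μ] G) := by
  obtain ⟨M, hM⟩ := hG.exists_isInvariantMean
  exact HartmanMycielski.extremelyAmenable_of_isInvariantMean hM hμ
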